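/- Let $F_n$ be the free group of rank $n$ on a fixed free basis $X=\{x_1,\dots,x_n\}$. An automorphism $\alpha$ of $F_n$ is called palindromic if each $\alpha(x_i)$ can be written as a palindrome on $X$, that is, as a word in the letters $X^{\pm1}$ that equals its reverse; these automorphisms form a subgroup $\Pi A_n$ of $\mathrm{Aut}(F_n)$. For $i\neq j$ let $P_{ij}$ be the elementary palindromic automorphism that sends $x_i$ to $x_jx_ix_j$ and fixes $x_l$ for all $l\neq i$. For $1\le j\le n$ let the inversion $\iota_j$ send $x_j$ to $x_j^{-1}$ and fix $x_l$ for all $l\ne j$. Let $\Omega^{\pm1}(X)$ be the subgroup of $\mathrm{Aut}(F_n)$ generated by the inversions and the permutations of $X$. **Proposition.** Fix $0\le k\le n$, and let $\Pi A_n(k)$ be the subgroup of $\Pi A_n$ consisting of the palindromic automorphisms that fix each of $x_1,\dots,x_k$ (so $\Pi A_n(0)=\Pi A_n$). Then $$\left[\Omega^{\pm1}(X)\cap \Pi A_n(k)\right]\ \cup\ \{P_{ij} \mid 1\le i,j\le n,\ i\neq j,\ i>k\}$$ is a finite generating set for $\Pi A_n(k)$. -/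

import Mathlib

namespace PalAut

/-- The free group `F_n` on the basis `X = {x_1, …, x_n}`.  The basis element `x_{i+1}` is
`FreeGroup.of i`, for `i : Fin n` (indices start at zero). -/
abbrev F (n : ℕ) : Type := FreeGroup (Fin n)

/-- `g` can be written as a palindrome on `X`: it is represented by some word in the letters
`X^{±1}` (a letter is a pair `(i, b)`, with `b = true` for `x_i` and `b = false` for `x_i⁻¹`)
that is equal to its reverse. -/
def IsPalindrome {n : ℕ} (g : F n) : Prop :=
  ∃ w : List (Fin n × Bool), w.reverse = w ∧ FreeGroup.mk w = g

/-- The automorphism is palindromic: it sends each element of `X` to a palindrome. -/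
def IsPalindromic {n : ℕ} (α : MulAut (F n)) : Prop :=
  ∀ i : Fin n, IsPalindrome (α (FreeGroup.of i))

/-- The endomorphism of `F_n` inverting each element of `X`; only used to check that the
palindromic automorphisms form a subgroup. -/
def invAll (n : ℕ) : F n →* F n := FreeGroup.lift fun i => (FreeGroup.of i)⁻¹

theorem invAll_mk {n : ℕ} (w : List (Fin n × Bool)) :
    invAll n (FreeGroup.mk w) = FreeGroup.mk (w.map fun p => (p.1, !p.2)) := by
  induction w with
  | nil => exact map_one (invAll n)
  | cons p w ih =>
    have h1 : FreeGroup.mk (p :: w) = FreeGroup.mk [p] * FreeGroup.mk w := by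
      rw [FreeGroup.mul_mk]; rfl
    have h2 : invAll n (FreeGroup.mk [p]) = FreeGroup.mk [(p.1, !p.2)] := by
      rcases p with ⟨i, b⟩
      cases b <;> simp [invAll, FreeGroup.of, FreeGroup.inv_mk, FreeGroup.invRev]
    rw [h1, map_mul, ih, h2, FreeGroup.mul_mk]
    rfl

theorem isPalindrome_iff {n : ℕ} (g : F n) : IsPalindrome g ↔ invAll n g = g⁻¹ := by
  constructor
  · rintro ⟨w, hw, rfl⟩
    rw [invAll_mk, FreeGroup.inv_mk, FreeGroup.invRev, ← List.map_reverse, hw]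
  · intro h
    refine ⟨g.toWord, ?_, FreeGroup.mk_toWord⟩
    set w := g.toWord with hw
    have hred : FreeGroup.IsReduced w := FreeGroup.isReduced_toWord
    have hg : FreeGroup.mk w = g := FreeGroup.mk_toWord
    have hflip : FreeGroup.IsReduced (w.map fun p => (p.1, !p.2)) := by
      unfold FreeGroup.IsReduced at hred ⊢
      rw [List.isChain_map]
      exact hred.imp fun a b hab heq => by simpa using hab heq
    have h1 : (w.map fun p => (p.1, !p.2)) = FreeGroup.invRev w := by
      have h2 : (invAll n g).toWord = (g⁻¹).toWord := by rw [h]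
      rw [← hg, invAll_mk, FreeGroup.toWord_mk, hflip.reduce_eq, hg,
        FreeGroup.toWord_inv] at h2
      exact h2
    rw [FreeGroup.invRev, ← List.map_reverse] at h1
    have hinj : Function.Injective (fun p : Fin n × Bool => (p.1, !p.2)) := by
      rintro ⟨a, b⟩ ⟨c, d⟩ hab
      simpa using hab
    exact (List.map_injective_iff.mpr hinj h1).symm

theorem isPalindromic_iff {n : ℕ} (α : MulAut (F n)) :
    IsPalindromic α ↔ ∀ g, invAll n (α g) = α (invAll n g) := by
  constructor
  · intro h
    have : (invAll n).comp α.toMonoidHom = α.toMonoidHom.comp (invAll n) := by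
      ext i
      have := (isPalindrome_iff _).1 (h i)
      simpa [invAll] using this
    exact fun g => DFunLike.congr_fun this g
  · intro h i
    rw [isPalindrome_iff, h]
    simp [invAll]

/-- The palindromic automorphism group `ΠA_n` of `F_n`. -/
def palAut (n : ℕ) : Subgroup (MulAut (F n)) where
  carrier := {α | IsPalindromic α}
  one_mem' := fun i => ⟨[(i, true)], rfl, rfl⟩
  mul_mem' := by
    intro α β hα hβ
    rw [Set.mem_ofPred_eq, isPalindromic_iff] at *
    intro g
    rw [MulAut.mul_apply, MulAut.mul_apply, hα, hβ]
  inv_mem' := by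
    intro α hα
    rw [Set.mem_ofPred_eq, isPalindromic_iff] at *
    intro g
    apply α.injective
    rw [← hα, MulAut.apply_inv_self, MulAut.apply_inv_self]

/-- The subgroup `ΠA_n(k)` of the palindromic automorphisms that fix `x_1, …, x_k`. -/
def palAutFix (n k : ℕ) : Subgroup (MulAut (F n)) where
  carrier := {α | α ∈ palAut n ∧ ∀ i : Fin n, i.val < k → α (FreeGroup.of i) = FreeGroup.of i}
  one_mem' := ⟨one_mem _, fun _ _ => rfl⟩
  mul_mem' := by
    rintro α β ⟨hα, hα'⟩ ⟨hβ, hβ'⟩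
    exact ⟨mul_mem hα hβ, fun i hi => by rw [MulAut.mul_apply, hβ' i hi, hα' i hi]⟩
  inv_mem' := by
    rintro α ⟨hα, hα'⟩
    exact ⟨inv_mem hα, fun i hi => α.injective (by rw [MulAut.apply_inv_self, hα' i hi])⟩

/-- The automorphism of `F_n` that permutes `X` by `σ`. -/
def perm {n : ℕ} (σ : Equiv.Perm (Fin n)) : MulAut (F n) := FreeGroup.freeGroupCongr σ

/-- The endomorphism of `F_n` sending `x_i` to `g` and fixing the other elements of `X`. -/
def replace {n : ℕ} (i : Fin n) (g : F n) : F n →* F n :=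
  FreeGroup.lift (Function.update FreeGroup.of i g)

theorem replace_self {n : ℕ} (i : Fin n) (g : F n) : replace i g (FreeGroup.of i) = g := by
  simp [replace]

theorem replace_of_ne {n : ℕ} {i l : Fin n} (h : l ≠ i) (g : F n) :
    replace i g (FreeGroup.of l) = FreeGroup.of l := by
  simp [replace, h]

/-- The inversion `ι_j`: it sends `x_j` to `x_j⁻¹` and fixes the other elements of `X`. -/
def inversion {n : ℕ} (j : Fin n) : MulAut (F n) :=
  MonoidHom.toMulEquiv (replace j (FreeGroup.of j)⁻¹) (replace j (FreeGroup.of j)⁻¹)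
    (by
      ext l
      by_cases h : l = j
      · subst h; simp [replace_self]
      · simp [replace_of_ne h])
    (by
      ext l
      by_cases h : l = j
      · subst h; simp [replace_self]
      · simp [replace_of_ne h])

/-- The elementary palindromic automorphism `P_ij` (`i ≠ j`): it sends `x_i` to `x_j x_i x_j`
and fixes the other elements of `X`. -/
def elementary {n : ℕ} (i j : Fin n) (hij : i ≠ j) : MulAut (F n) :=
  MonoidHom.toMulEquiv
    (replace i (FreeGroup.of j * FreeGroup.of i * FreeGroup.of j))
    (replace i ((FreeGroup.of j)⁻¹ * FreeGroup.of i * (FreeGroup.of j)⁻¹))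
    (by
      ext l
      by_cases h : l = i
      · subst h; simp [replace_self, replace_of_ne hij.symm, mul_assoc]
      · simp [replace_of_ne h])
    (by
      ext l
      by_cases h : l = i
      · subst h; simp [replace_self, replace_of_ne hij.symm, mul_assoc]
      · simp [replace_of_ne h])

/-- The group `Ω^{±1}(X)` generated by the inversions and the permutations of `X`. -/
def signedPerms (n : ℕ) : Subgroup (MulAut (F n)) :=
  Subgroup.closure (Set.range (inversion (n := n)) ∪ Set.range (perm (n := n)))

/-- The set `[Ω^{±1}(X) ∩ ΠA_n(k)] ∪ {P_ij | i > k}`; since `Fin n` starts at zero, the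
condition `i > k` on the index of `x_i` reads `k ≤ i.val`. -/
def generators (n k : ℕ) : Set (MulAut (F n)) :=
  ((signedPerms n : Set (MulAut (F n))) ∩ (palAutFix n k : Set (MulAut (F n)))) ∪
    {P | ∃ (i j : Fin n) (hij : i ≠ j), k ≤ i.val ∧ P = elementary i j hij}

end PalAut

/-!
A palindromic automorphism `α` sends every letter `a` of `X^{±1}` to a palindrome of odd length,
say `u c ū` with `ū` the reverse of `u`: an even palindrome `u ū` is a square modulo commutators,
whereas `a` is not. Call `u c` the half of `α(a)`. If the half of `α(a)` is a proper prefix of the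
half of `α(b)`, then `α(a⁻¹ b a⁻¹)` is shorter than `α(b)`, so composing `α` with some `P_ij^{±1}`
decreases the total length of the images of `X`. If no half is a prefix of another one, then in
`α(a) α(b)`, with `a b` reduced, the cancellation reaches neither of the two central letters. Hence
`α` does not decrease the length of any word, `α⁻¹` sends letters to letters, and `α` is a signed
permutation. A basis element fixed by `α` is never the one shortened, so the reduction stays inside
`ΠA_n(k)` and uses only `P_ij` with `i > k`.
-/

namespace PalAut

open FreeGroup hiding IsReduced map_inv map_mul norm norm_eq_zero

section Words

variable {ι : Type*}

/-- The letter `x_i^{∓1}` inverse to the letter `x_i^{±1}`. -/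
def invLetter (a : ι × Bool) : ι × Bool := (a.1, !a.2)

theorem invLetter_invLetter (a : ι × Bool) : invLetter (invLetter a) = a := by
  simp [invLetter]

theorem invLetter_injective : Function.Injective (invLetter (ι := ι)) :=
  Function.LeftInverse.injective invLetter_invLetter

theorem eq_or_eq_invLetter_of_fst_eq {a b : ι × Bool} (h : a.1 = b.1) :
    a = b ∨ a = invLetter b := by
  rcases Bool.eq_or_eq_not a.2 b.2 with h' | h'
  · exact Or.inl (Prod.ext h h')
  · exact Or.inr (Prod.ext h h')

theorem mk_invLetter (a : ι × Bool) : mk [invLetter a] = (mk [a])⁻¹ := by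
  simp [invLetter, inv_mk, invRev]

theorem mk_singleton_false (i : ι) : mk [(i, false)] = (of i)⁻¹ :=
  mk_invLetter (i, true)

theorem mk_singleton_injective : Function.Injective fun a : ι × Bool => mk [a] := by
  classical
  intro a b h
  simpa using reduce.sound h

theorem mk_cons (a : ι × Bool) (w : List (ι × Bool)) : mk (a :: w) = mk [a] * mk w := by
  rw [mul_mk, List.singleton_append]

theorem invRev_eq_reverse_map (w : List (ι × Bool)) : invRev w = (w.map invLetter).reverse :=
  rfl

theorem isReduced_map_invLetter {w : List (ι × Bool)} (hw : FreeGroup.IsReduced w) :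
    FreeGroup.IsReduced (w.map invLetter) := by
  rw [FreeGroup.IsReduced, List.isChain_map]
  exact hw.imp fun a b hab h => congrArg (!·) (hab h)

theorem exists_cancellation {u v : List (ι × Bool)} (hu : FreeGroup.IsReduced u)
    (hv : FreeGroup.IsReduced v) :
    ∃ x p y, u = x ++ invRev p ∧ v = p ++ y ∧ FreeGroup.IsReduced (x ++ y) := by
  induction v generalizing u with
  | nil => exact ⟨u, [], [], by simp, rfl, by simpa using hu⟩
  | cons b v ih =>
    by_cases hb : ∃ u', u = u' ++ [invLetter b]
    · obtain ⟨u', rfl⟩ := hb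
      obtain ⟨x, p, y, rfl, rfl, hxy⟩ :=
        ih (hu.infix (List.prefix_append _ _).isInfix) (hv.infix (List.suffix_cons _ _).isInfix)
      exact ⟨x, b :: p, y, by simp [invRev, invLetter], rfl, hxy⟩
    · refine ⟨u, [], b :: v, by simp, rfl, List.isChain_append.2 ⟨hu, hv, ?_⟩⟩
      rintro a ha _ ⟨⟩ hab
      rcases eq_or_eq_invLetter_of_fst_eq hab with rfl | rfl
      · rfl
      · exact absurd (List.getLast?_eq_some_iff.1 ha) hb

theorem exists_toWord_mul [DecidableEq ι] (g h : FreeGroup ι) :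
    ∃ x p y, g.toWord = x ++ invRev p ∧ h.toWord = p ++ y ∧ (g * h).toWord = x ++ y := by
  obtain ⟨x, p, y, hg, hh, hxy⟩ :=
    exists_cancellation (isReduced_toWord (x := g)) (isReduced_toWord (x := h))
  have hgh : g * h = mk (x ++ y) := by
    rw [← mk_toWord (x := g), ← mk_toWord (x := h), hg, hh]
    simp only [← mul_mk, ← inv_mk]
    group
  exact ⟨x, p, y, hg, hh, by rw [hgh, toWord_mk, hxy.reduce_eq]⟩

theorem norm_eq_one_iff [DecidableEq ι] {g : FreeGroup ι} : g.norm = 1 ↔ ∃ a, g = mk [a] := by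
  refine List.length_eq_one_iff.trans (exists_congr fun a => ?_)
  rw [← toWord_inj, toWord_mk, FreeGroup.IsReduced.singleton.reduce_eq]

theorem finite_setOf_norm_eq_one [Finite ι] [DecidableEq ι] :
    {g : FreeGroup ι | g.norm = 1}.Finite :=
  (Set.finite_range fun a => mk [a]).subset fun _ hg =>
    (norm_eq_one_iff.1 hg).imp fun _ => Eq.symm

end Words

section Palindromes

theorem exists_of_palindrome {β : Type*} {l : List β} (h : l.Palindrome) :
    (∃ u, l = u ++ u.reverse) ∨ ∃ u c, l = u ++ c :: u.reverse := by
  induction h with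
  | nil => exact Or.inl ⟨[], rfl⟩
  | singleton x => exact Or.inr ⟨[], x, rfl⟩
  | cons_concat x _ ih =>
    rcases ih with ⟨u, rfl⟩ | ⟨u, c, rfl⟩
    · exact Or.inl ⟨x :: u, by simp⟩
    · exact Or.inr ⟨x :: u, c, by simp⟩

theorem append_cons_reverse_inj {β : Type*} {u v : List β} {c d : β}
    (h : u ++ c :: u.reverse = v ++ d :: v.reverse) : u = v ∧ c = d := by
  have hlen : u.length = v.length := by
    have := congrArg List.length h
    simp only [List.length_append, List.length_cons, List.length_reverse] at this
    omega
  obtain ⟨huv, hcd⟩ := List.append_inj h hlen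
  exact ⟨huv, (List.cons.inj hcd).1⟩

variable {ι A : Type*} [CommGroup A]

theorem map_mk_reverse (ψ : FreeGroup ι →* A) (u : List (ι × Bool)) :
    ψ (mk u.reverse) = ψ (mk u) := by
  induction u with
  | nil => rfl
  | cons a u ih => rw [List.reverse_cons, ← mul_mk, map_mul, ih, mk_cons a u, map_mul, mul_comm]

theorem isSquare_map_mk_append_reverse (ψ : FreeGroup ι →* A) (u : List (ι × Bool)) :
    IsSquare (ψ (mk (u ++ u.reverse))) :=
  ⟨ψ (mk u), by rw [← mul_mk, map_mul, map_mk_reverse]⟩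

variable {n : ℕ}

theorem toWord_invAll (g : F n) : (invAll n g).toWord = g.toWord.map invLetter := by
  have h : invAll n g = mk (g.toWord.map invLetter) := by
    rw [← mk_toWord (x := g), invAll_mk, mk_toWord]
    rfl
  rw [h, toWord_mk, (isReduced_map_invLetter isReduced_toWord).reduce_eq]

theorem IsPalindrome.toWord_palindrome {g : F n} (hg : IsPalindrome g) : g.toWord.Palindrome := by
  have h : g.toWord.map invLetter = g.toWord.reverse.map invLetter := by
    rw [← toWord_invAll, (isPalindrome_iff g).1 hg, toWord_inv, List.map_reverse]
    rfl
  exact .of_reverse_eq (List.map_injective_iff.2 invLetter_injective h).symm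

theorem IsPalindrome.inv {g : F n} (hg : IsPalindrome g) : IsPalindrome g⁻¹ := by
  rw [isPalindrome_iff] at hg ⊢
  rw [map_inv, hg]

theorem IsPalindromic.isPalindrome_apply_letter {α : MulAut (F n)} (hα : IsPalindromic α)
    (a : Fin n × Bool) : IsPalindrome (α (mk [a])) := by
  rcases a with ⟨i, _ | _⟩
  · rw [mk_singleton_false, map_inv]
    exact (hα i).inv
  · exact hα i

theorem IsPalindromic.exists_toWord_apply_letter {α : MulAut (F n)} (hα : IsPalindromic α)
    (a : Fin n × Bool) : ∃ u c, (α (mk [a])).toWord = u ++ c :: u.reverse := by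
  refine (exists_of_palindrome (hα.isPalindrome_apply_letter a).toWord_palindrome).resolve_left ?_
  rintro ⟨u, hu⟩
  let exponentSum : F n →* Multiplicative ℤ := FreeGroup.lift fun _ => Multiplicative.ofAdd 1
  have hsq : IsSquare (exponentSum (mk [a])) := by
    have h := isSquare_map_mk_append_reverse (exponentSum.comp α.symm.toMonoidHom) u
    rwa [← hu, mk_toWord, MonoidHom.comp_apply, MulEquiv.coe_toMonoidHom,
      MulEquiv.symm_apply_apply] at h
  rcases a with ⟨i, _ | _⟩ <;>
    simp [exponentSum, ← ofAdd_neg, isSquare_ofAdd_iff] at hsq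

end Palindromes

section Nielsen

theorem prefix_of_prefix_append_cons {β : Type*} {p u v s t : List β} {c d : β}
    (hu : p <+: u ++ c :: s) (hv : p <+: v ++ d :: t)
    (huv : ¬ u ++ [c] <+: v ++ [d]) (hvu : ¬ v ++ [d] <+: u ++ [c]) : p <+: u := by
  rw [List.append_cons] at hu hv
  have not_isPrefix : ¬ u ++ [c] <+: p := fun h =>
    (List.prefix_or_prefix_of_prefix (h.trans hv) (List.prefix_append _ _)).elim huv hvu
  have hp : p <+: u ++ [c] :=
    (List.prefix_or_prefix_of_prefix hu (List.prefix_append _ _)).resolve_right not_isPrefix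
  exact (List.prefix_concat_iff.1 hp).resolve_left fun h => not_isPrefix (h ▸ List.prefix_rfl)

variable {ι κ : Type*} [DecidableEq κ]

/-- A homomorphism of free groups is Nielsen reduced with central letters `c a` if the reduced
image of each letter `a` splits as `L a ++ c a :: R a`, compatibly with inversion, so that the
initial segments `L a ++ [c a]` form a prefix code. Compatibility with inversion forces `R a` to be
the inverse of `L (invLetter a)`, hence `R` does not occur. -/
structure IsNielsenReduced (φ : FreeGroup ι →* FreeGroup κ) (L : ι × Bool → List (κ × Bool))
    (c : ι × Bool → κ × Bool) : Prop where
  toWord_map : ∀ a, (φ (mk [a])).toWord = L a ++ c a :: invRev (L (invLetter a))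
  prefix_free : ∀ a b, L a ++ [c a] <+: L b ++ [c b] → a = b

namespace IsNielsenReduced

variable {φ : FreeGroup ι →* FreeGroup κ} {L : ι × Bool → List (κ × Bool)}
  {c : ι × Bool → κ × Bool}

theorem exists_toWord_map_mul (hφ : IsNielsenReduced φ L c) {a b : ι × Bool}
    (hab : invLetter a ≠ b) {h : FreeGroup κ} {t : List (κ × Bool)}
    (hh : h.toWord = L b ++ c b :: t) :
    ∃ z, (φ (FreeGroup.mk [a]) * h).toWord = L a ++ c a :: (z ++ c b :: t) := by
  obtain ⟨x, p, y, hx, hy, hxy⟩ := exists_toWord_mul (φ (FreeGroup.mk [a])) h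
  have ha : p <+: L (invLetter a) ++ c (invLetter a) :: invRev (L (invLetter (invLetter a))) :=
    ⟨invRev x, by rw [← hφ.toWord_map, mk_invLetter, map_inv, toWord_inv, hx]; simp⟩
  have hb : p <+: L b ++ c b :: t := ⟨y, by rw [← hh, hy]⟩
  have not_ab := mt (hφ.prefix_free (invLetter a) b) hab
  have not_ba := mt (hφ.prefix_free b (invLetter a)) hab.symm
  obtain ⟨r, hr⟩ := prefix_of_prefix_append_cons ha hb not_ab not_ba
  obtain ⟨s, hs⟩ := prefix_of_prefix_append_cons hb ha not_ba not_ab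
  have hx' : x = L a ++ c a :: invRev r := by
    rw [hφ.toWord_map, ← hr, invRev_append, ← List.cons_append, ← List.append_assoc] at hx
    exact (List.append_cancel_right hx).symm
  have hy' : y = s ++ c b :: t := by
    rw [hh, ← hs, List.append_assoc] at hy
    exact (List.append_cancel_left hy).symm
  exact ⟨invRev r ++ s, by rw [hxy, hx', hy']; simp⟩

theorem exists_toWord_map_mk_cons (hφ : IsNielsenReduced φ L c) {a : ι × Bool}
    {w : List (ι × Bool)} (hw : FreeGroup.IsReduced (a :: w)) :
    ∃ t, (φ (FreeGroup.mk (a :: w))).toWord = L a ++ c a :: t ∧ w.length ≤ t.length := by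
  induction w generalizing a with
  | nil => exact ⟨_, hφ.toWord_map a, Nat.zero_le _⟩
  | cons b w ih =>
    obtain ⟨hab, hbw⟩ := isReduced_cons_cons.1 hw
    obtain ⟨t, ht, hlen⟩ := ih hbw
    have hne : invLetter a ≠ b := by
      rintro rfl
      exact Bool.self_ne_not _ (hab rfl)
    obtain ⟨z, hz⟩ := hφ.exists_toWord_map_mul hne ht
    refine ⟨z ++ c b :: t, by rw [mk_cons, map_mul, hz], ?_⟩
    simp only [List.length_cons, List.length_append]
    omega

theorem norm_le_norm_map [DecidableEq ι] (hφ : IsNielsenReduced φ L c) (g : FreeGroup ι) :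
    g.norm ≤ (φ g).norm := by
  have hred : FreeGroup.IsReduced g.toWord := isReduced_toWord
  rw [FreeGroup.norm]
  nth_rewrite 2 [← mk_toWord (x := g)]
  generalize g.toWord = w at hred ⊢
  cases w with
  | nil => exact Nat.zero_le _
  | cons a w =>
    obtain ⟨t, ht, hlen⟩ := hφ.exists_toWord_map_mk_cons hred
    rw [FreeGroup.norm, ht]
    simp only [List.length_cons, List.length_append]
    omega

end IsNielsenReduced

theorem norm_inv_mul_mul_inv_lt {u v : List (κ × Bool)} {c d : κ × Bool} (h : u ++ [c] <+: v) :
    ((mk (u ++ c :: u.reverse))⁻¹ * mk (v ++ d :: v.reverse) *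
      (mk (u ++ c :: u.reverse))⁻¹).norm < (v ++ d :: v.reverse).length := by
  obtain ⟨s, rfl⟩ := h
  have hmid : (mk (u ++ c :: u.reverse))⁻¹ *
      mk (u ++ [c] ++ s ++ d :: (u ++ [c] ++ s).reverse) * (mk (u ++ c :: u.reverse))⁻¹ =
      mk (invRev u.reverse ++ (s ++ d :: s.reverse) ++ invRev u) := by
    simp only [List.reverse_append, List.reverse_singleton, ← mul_mk, ← inv_mk,
      mk_cons c u.reverse, mk_cons d s.reverse, mk_cons d (s.reverse ++ ([c] ++ u.reverse))]
    group
  rw [hmid]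
  refine norm_mk_le.trans_lt ?_
  simp only [List.length_append, List.length_cons, List.length_reverse, invRev_length]
  omega

section OddPalindromes

variable {φ : FreeGroup ι →* FreeGroup κ} {L : ι × Bool → List (κ × Bool)}
  {c : ι × Bool → κ × Bool}

theorem left_invLetter (hword : ∀ a, (φ (mk [a])).toWord = L a ++ c a :: (L a).reverse)
    (a : ι × Bool) : L (invLetter a) = (L a).map invLetter := by
  refine (append_cons_reverse_inj (c := c (invLetter a)) (d := invLetter (c a)) ?_).1
  rw [← hword, mk_invLetter, map_inv, toWord_inv, hword]
  simp [invRev_eq_reverse_map]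

theorem fst_ne_of_left_isPrefix (hword : ∀ a, (φ (mk [a])).toWord = L a ++ c a :: (L a).reverse)
    {a b : ι × Bool} (h : L a ++ [c a] <+: L b) : a.1 ≠ b.1 := by
  intro hab
  have hlen : (L a).length = (L b).length := by
    rcases eq_or_eq_invLetter_of_fst_eq hab with rfl | rfl
    · rfl
    · rw [left_invLetter hword, List.length_map]
  have hle := h.length_le
  rw [List.length_append, List.length_singleton] at hle
  omega

theorem norm_map_conj_lt (hword : ∀ a, (φ (mk [a])).toWord = L a ++ c a :: (L a).reverse)
    {a b : ι × Bool} (h : L a ++ [c a] <+: L b) :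
    (φ ((mk [a])⁻¹ * mk [b] * (mk [a])⁻¹)).norm < (φ (mk [b])).norm := by
  have hlt := norm_inv_mul_mul_inv_lt (d := c b) h
  rw [← hword, ← hword, mk_toWord, mk_toWord] at hlt
  rwa [map_mul, map_mul, map_inv]

theorem isNielsenReduced_of_norm_le (hinj : Function.Injective φ)
    (hword : ∀ a, (φ (mk [a])).toWord = L a ++ c a :: (L a).reverse)
    (hmin : ∀ a i, a.1 ≠ i → (φ (of i)).norm ≤ (φ (mk [a] * of i * mk [a])).norm) :
    IsNielsenReduced φ L c where
  toWord_map a := by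
    rw [hword, left_invLetter hword]
    simp [invRev_eq_reverse_map, Function.comp_def, invLetter_invLetter]
  prefix_free a b hab := by
    rcases List.prefix_concat_iff.1 hab with heq | hlt
    · obtain ⟨hL, hc⟩ := List.append_inj' heq rfl
      have himage : φ (mk [a]) = φ (mk [b]) := by
        rw [← toWord_inj, hword, hword, hL, List.singleton_inj.1 hc]
      exact mk_singleton_injective (hinj himage)
    · have hne := fst_ne_of_left_isPrefix hword hlt
      refine absurd (norm_map_conj_lt hword hlt) (not_lt.2 ?_)
      rcases b with ⟨i, _ | _⟩
      · have hconj : (mk [a])⁻¹ * (of i)⁻¹ * (mk [a])⁻¹ = (mk [a] * of i * mk [a])⁻¹ := by group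
        rw [mk_singleton_false, hconj, map_inv, map_inv, norm_inv_eq, norm_inv_eq]
        exact hmin a i hne
      · rw [← mk_invLetter]
        exact hmin (invLetter a) i hne

end OddPalindromes

end Nielsen

section SignedPermutations

variable {n : ℕ}

theorem perm_mem_signedPerms (σ : Equiv.Perm (Fin n)) : perm σ ∈ signedPerms n :=
  Subgroup.subset_closure (Or.inr ⟨σ, rfl⟩)

theorem inversion_mem_signedPerms (j : Fin n) : inversion j ∈ signedPerms n :=
  Subgroup.subset_closure (Or.inl ⟨j, rfl⟩)

theorem perm_apply_of (σ : Equiv.Perm (Fin n)) (i : Fin n) : perm σ (of i) = of (σ i) :=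
  map.of

theorem inversion_apply_self (j : Fin n) : inversion j (of j) = (of j)⁻¹ :=
  replace_self j _

theorem inversion_apply_of_ne {j l : Fin n} (h : l ≠ j) : inversion j (of l) = of l :=
  replace_of_ne h _

theorem mulAut_ext {ι : Type*} {β γ : MulAut (FreeGroup ι)} (h : ∀ i, β (of i) = γ (of i)) :
    β = γ :=
  MulEquiv.toMonoidHom_injective (ext_hom _ _ h)

theorem mem_signedPerms_of_apply_of_eq_of {β : MulAut (F n)} {f : Fin n → Fin n}
    (h : ∀ i, β (of i) = of (f i)) : β ∈ signedPerms n := by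
  have hinj : Function.Injective f := fun i j hij =>
    of_injective (β.injective (by rw [h, h, hij]))
  have hβ : β = perm (Equiv.ofBijective f (Finite.injective_iff_bijective.1 hinj)) :=
    mulAut_ext fun i => by rw [h, perm_apply_of, Equiv.ofBijective_apply]
  exact hβ ▸ perm_mem_signedPerms _

theorem exists_mem_signedPerms_inverting (s : Finset (Fin n)) :
    ∃ ε ∈ signedPerms n, ∀ i, ε (of i) = if i ∈ s then (of i)⁻¹ else of i := by
  induction s using Finset.induction_on with
  | empty => exact ⟨1, one_mem _, fun i => by simp⟩
  | insert j s hj ih =>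
    obtain ⟨ε, hε, hεs⟩ := ih
    refine ⟨ε * inversion j, mul_mem hε (inversion_mem_signedPerms j), fun i => ?_⟩
    rcases eq_or_ne i j with rfl | hij
    · simp [inversion_apply_self, hεs, hj]
    · simp [inversion_apply_of_ne hij, hεs, hij]

theorem mem_signedPerms_of_norm_eq_one {β : MulAut (F n)} (h : ∀ i, (β (of i)).norm = 1) :
    β ∈ signedPerms n := by
  choose a ha using fun i => norm_eq_one_iff.1 (h i)
  obtain ⟨ε, hε, hεs⟩ := exists_mem_signedPerms_inverting {i | (a i).2 = false}
  refine (Subgroup.mul_mem_cancel_right _ hε).1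
    (mem_signedPerms_of_apply_of_eq_of (f := fun i => (a i).1) fun i => ?_)
  rw [MulAut.mul_apply, hεs]
  rcases hi : a i with ⟨j, _ | _⟩
  · rw [if_pos (by simp [hi]), map_inv, ha, hi, mk_singleton_false, inv_inv]
  · rw [if_neg (by simp [hi]), ha, hi]
    rfl

open scoped Pointwise in
theorem signedPerms_le_stabilizer :
    signedPerms n ≤ MulAction.stabilizer (MulAut (F n)) {g : F n | g.norm = 1} := by
  refine (Subgroup.closure_le _).2 fun β hβ => ?_
  have hof : ∀ i, (β (of i)).norm = 1 := by
    intro i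
    rcases hβ with ⟨j, rfl⟩ | ⟨σ, rfl⟩
    · rcases eq_or_ne i j with rfl | hij
      · rw [inversion_apply_self, norm_inv_eq, norm_of]
      · rw [inversion_apply_of_ne hij, norm_of]
    · rw [perm_apply_of, norm_of]
  refine (MulAction.mem_stabilizer_set_iff_smul_set_subset finite_setOf_norm_eq_one).2 ?_
  rintro _ ⟨g, hg, rfl⟩
  obtain ⟨⟨i, _ | _⟩, rfl⟩ := norm_eq_one_iff.1 hg
  · change (β (mk [(i, false)])).norm = 1
    rw [mk_singleton_false, map_inv, norm_inv_eq, hof]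
  · exact hof i

theorem norm_apply_of_eq_one {β : MulAut (F n)} (hβ : β ∈ signedPerms n) (i : Fin n) :
    (β (of i)).norm = 1 :=
  (MulAction.mem_stabilizer_set.1 (signedPerms_le_stabilizer hβ) (of i)).2 (norm_of i)

theorem signedPerms_finite : (signedPerms n : Set (MulAut (F n))).Finite :=
  Set.Finite.of_injOn (f := fun β i => β (of i))
    (t := Set.univ.pi fun _ : Fin n => {g : F n | g.norm = 1})
    (fun _ hβ i _ => norm_apply_of_eq_one hβ i)
    (fun _ _ _ _ h => mulAut_ext (congrFun h))
    (Set.Finite.pi fun _ => finite_setOf_norm_eq_one)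

end SignedPermutations

section Generators

variable {n k : ℕ} {i j : Fin n}

theorem elementary_apply_self (hij : i ≠ j) : elementary i j hij (of i) = of j * of i * of j :=
  replace_self i _

theorem elementary_apply_of_ne (hij : i ≠ j) {l : Fin n} (hl : l ≠ i) :
    elementary i j hij (of l) = of l :=
  replace_of_ne hl _

theorem elementary_inv_apply_self (hij : i ≠ j) :
    (elementary i j hij)⁻¹ (of i) = (of j)⁻¹ * of i * (of j)⁻¹ :=
  replace_self i _

theorem exists_mem_zpowers_elementary_apply_self (a : Fin n × Bool) (hia : i ≠ a.1) :
    ∃ P ∈ Subgroup.zpowers (elementary i a.1 hia), P (of i) = mk [a] * of i * mk [a] := by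
  rcases a with ⟨j, _ | _⟩
  · exact ⟨_, inv_mem (Subgroup.mem_zpowers _),
      by rw [elementary_inv_apply_self, mk_singleton_false]⟩
  · exact ⟨_, Subgroup.mem_zpowers _, elementary_apply_self hia⟩

theorem apply_of_ne_of_mem_zpowers_elementary {hij : i ≠ j} {P : MulAut (F n)}
    (hP : P ∈ Subgroup.zpowers (elementary i j hij)) {l : Fin n} (hl : l ≠ i) :
    P (of l) = of l := by
  have hle : Subgroup.zpowers (elementary i j hij) ≤ MulAction.stabilizer _ (of l) :=
    Subgroup.zpowers_le.2 (elementary_apply_of_ne hij hl)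
  exact hle hP

theorem elementary_mem_palAutFix (hij : i ≠ j) (hi : k ≤ i.val) :
    elementary i j hij ∈ palAutFix n k := by
  refine ⟨fun l => ?_, fun l hl => elementary_apply_of_ne hij ?_⟩
  · rcases eq_or_ne l i with rfl | hl
    · exact ⟨[(j, true), (l, true), (j, true)], rfl, (elementary_apply_self hij).symm⟩
    · exact ⟨[(l, true)], rfl, (elementary_apply_of_ne hij hl).symm⟩
  · rintro rfl
    omega

theorem generators_finite (n k : ℕ) : (generators n k).Finite := by
  refine (signedPerms_finite.subset Set.inter_subset_left).union ?_
  refine (Set.finite_range fun p : {p : Fin n × Fin n // p.1 ≠ p.2} =>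
    elementary p.1.1 p.1.2 p.2).subset ?_
  rintro _ ⟨i, j, hij, _, rfl⟩
  exact ⟨⟨(i, j), hij⟩, rfl⟩

theorem closure_generators_le (n k : ℕ) :
    Subgroup.closure (generators n k) ≤ palAutFix n k := by
  refine (Subgroup.closure_le _).2 ?_
  rintro _ (h | ⟨i, j, hij, hi, rfl⟩)
  · exact h.2
  · exact elementary_mem_palAutFix hij hi

end Generators

section Reduction

variable {n k : ℕ} {α P : MulAut (F n)} {i j : Fin n} {hij : i ≠ j}

theorem IsPalindromic.mem_signedPerms_of_norm_le (hα : IsPalindromic α)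
    (hmin : ∀ a i, a.1 ≠ i → (α (of i)).norm ≤ (α (mk [a] * of i * mk [a])).norm) :
    α ∈ signedPerms n := by
  choose L c hword using hα.exists_toWord_apply_letter
  have hred : IsNielsenReduced α.toMonoidHom L c :=
    isNielsenReduced_of_norm_le α.injective hword hmin
  refine inv_mem_iff.1 (mem_signedPerms_of_norm_eq_one fun i => le_antisymm ?_ ?_)
  · calc (α⁻¹ (of i)).norm ≤ (α (α⁻¹ (of i))).norm := hred.norm_le_norm_map _
      _ = 1 := by rw [MulAut.apply_inv_self, norm_of]
  · rw [Nat.one_le_iff_ne_zero, Ne, FreeGroup.norm_eq_zero, EmbeddingLike.map_eq_one_iff]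
    exact of_ne_one i

theorem IsPalindromic.exists_shortening (hα : IsPalindromic α) (hns : α ∉ signedPerms n) :
    ∃ (i j : Fin n) (hij : i ≠ j), ∃ P ∈ Subgroup.zpowers (elementary i j hij),
      (α (P (of i))).norm < (α (of i)).norm := by
  contrapose! hns
  refine hα.mem_signedPerms_of_norm_le fun a i hai => ?_
  obtain ⟨P, hP, hPi⟩ := exists_mem_zpowers_elementary_apply_self a hai.symm
  exact hPi ▸ hns i a.1 hai.symm P hP

theorem le_val_of_norm_lt (hα : α ∈ palAutFix n k)
    (hlt : (α (P (of i))).norm < (α (of i)).norm) : k ≤ i.val := by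
  by_contra! hi
  rw [hα.2 i hi, norm_of, Nat.lt_one_iff, FreeGroup.norm_eq_zero, EmbeddingLike.map_eq_one_iff,
    EmbeddingLike.map_eq_one_iff] at hlt
  exact of_ne_one i hlt

theorem sum_norm_mul_lt (hP : P ∈ Subgroup.zpowers (elementary i j hij))
    (hlt : (α (P (of i))).norm < (α (of i)).norm) :
    ∑ l, ((α * P) (of l)).norm < ∑ l, (α (of l)).norm := by
  refine Finset.sum_lt_sum (fun l _ => ?_) ⟨i, Finset.mem_univ i, hlt⟩
  rcases eq_or_ne l i with rfl | hl
  · exact hlt.le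
  · rw [MulAut.mul_apply, apply_of_ne_of_mem_zpowers_elementary hP hl]

theorem palAutFix_le_closure_generators (n k : ℕ) :
    palAutFix n k ≤ Subgroup.closure (generators n k) := by
  intro α hα
  induction hN : ∑ l, (α (of l)).norm using Nat.strong_induction_on generalizing α with
  | _ N ih =>
    subst hN
    by_cases hs : α ∈ signedPerms n
    · exact Subgroup.subset_closure (Or.inl ⟨hs, hα⟩)
    obtain ⟨i, j, hij, P, hP, hlt⟩ := IsPalindromic.exists_shortening hα.1 hs
    have hi : k ≤ i.val := le_val_of_norm_lt hα hlt
    have hle : Subgroup.zpowers (elementary i j hij) ≤ Subgroup.closure (generators n k) :=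
      Subgroup.zpowers_le.2 (Subgroup.subset_closure (Or.inr ⟨i, j, hij, hi, rfl⟩))
    have hαP : α * P ∈ palAutFix n k := mul_mem hα (closure_generators_le n k (hle hP))
    exact (Subgroup.mul_mem_cancel_right _ (hle hP)).1 (ih _ (sum_norm_mul_lt hP hlt) hαP rfl)

end Reduction

end PalAut

theorem mainTheorem4 (n k : ℕ) (hk : k ≤ n) :
    (PalAut.generators n k).Finite ∧
      Subgroup.closure (PalAut.generators n k) = PalAut.palAutFix n k :=
  ⟨PalAut.generators_finite n k,
    le_antisymm (PalAut.closure_generators_le n k) (PalAut.palAutFix_le_closure_generators n k)⟩
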